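/- For integers $1 \le k \le n$, a ternary $[n,k]$ code is a $k$-dimensional subspace $C$ of $\mathbb{F}_3^n$. Its minimum weight is the least number of nonzero coordinates of a nonzero vector of $C$, and its dual is $C^\perp=\{x\in\mathbb{F}_3^n \mid \sum_{i=1}^n x_iy_i=0 \text{ for all } y\in C\}$. The code $C$ is linear complementary dual (LCD) if $C\cap C^\perp=\{0\}$. Let $d_3(n,k)$ denote the largest minimum weight among all ternary LCD $[n,k]$ codes. **Theorem.** Let $n\ge 4$ be an integer. If $n \equiv 4,5,7,8,10,11,14,16,17,19,20,24,26,29,30,33,35,36,38,39 \pmod{40}$, then $$d_3(n,4)=\left\lfloor \frac{27n}{40}\right\rfloor-1.$$ If $n\equiv 6 \pmod{40}$, then $$d_3(n,4)=\left\lfloor \frac{27n}{40}\right\rfloor-2.$$ -/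

import Mathlib

/-- A linear code of length `n` over `F` is a subspace of `F ^ n`. -/
abbrev LinearCode (F : Type*) [Field F] (n : ℕ) : Type _ := Submodule F (Fin n → F)

namespace LinearCode

variable {F : Type*} [Field F] {n : ℕ}

/-- The dual code `{x | ⟨x, y⟩ = 0 for all y ∈ C}`, where `⟨x, y⟩ = ∑ i, x i * y i`. -/
def dual (C : LinearCode F n) : LinearCode F n where
  carrier := {x | ∀ y ∈ C, ∑ i, x i * y i = 0}
  zero_mem' := by
    intro y _
    simp
  add_mem' := by
    intro a b ha hb y hy
    simp [add_mul, Finset.sum_add_distrib, ha y hy, hb y hy]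
  smul_mem' := by
    intro c a ha y hy
    simp [mul_assoc, ← Finset.mul_sum, ha y hy]

/-- A code is linear complementary dual if it meets its dual trivially. -/
def IsLCD (C : LinearCode F n) : Prop := C ⊓ C.dual = ⊥

/-- The minimum weight: the least number of nonzero coordinates of a nonzero codeword
(with the value `0` for the zero code, which has no nonzero codeword). -/
noncomputable def minWeight [DecidableEq F] (C : LinearCode F n) : ℕ :=
  sInf {w | ∃ x ∈ C, x ≠ 0 ∧ hammingNorm x = w}

end LinearCode

/-- The minimum weights of the LCD `[n, k]` codes over `F`. -/
def lcdMinWeights (F : Type*) [Field F] [DecidableEq F] (n k : ℕ) : Set ℕ :=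
  {d | ∃ C : LinearCode F n, Module.finrank F C = k ∧ C.IsLCD ∧ C.minWeight = d}

/-- `d_q(n, k)`: the largest minimum weight among all LCD `[n, k]` codes over the field `F`
with `q` elements. -/
noncomputable def largestLCDMinWeight (F : Type*) [Field F] [DecidableEq F] (n k : ℕ) : ℕ :=
  sSup (lcdMinWeights F n k)

/-- Minimum weights are at most the length. -/
theorem bddAbove_lcdMinWeights (F : Type*) [Field F] [DecidableEq F] (n k : ℕ) :
    BddAbove (lcdMinWeights F n k) := by
  refine ⟨n, ?_⟩
  rintro d ⟨C, -, -, rfl⟩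
  unfold LinearCode.minWeight
  rcases Set.eq_empty_or_nonempty {w | ∃ x ∈ C, x ≠ 0 ∧ hammingNorm x = w} with h | h
  · rw [h]
    simp
  · obtain ⟨x, -, -, hx⟩ := Nat.sInf_mem h
    rw [← hx]
    simpa using hammingNorm_le_card_fintype (x := x)

/-- A nonzero value of `largestLCDMinWeight` is attained and is a genuine maximum. -/
theorem isGreatest_largestLCDMinWeight (F : Type*) [Field F] [DecidableEq F] (n k : ℕ)
    (h : largestLCDMinWeight F n k ≠ 0) :
    IsGreatest (lcdMinWeights F n k) (largestLCDMinWeight F n k) := by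
  have hne : (lcdMinWeights F n k).Nonempty := by
    by_contra hc
    rw [Set.not_nonempty_iff_eq_empty] at hc
    exact h (by simp [largestLCDMinWeight, hc])
  exact ⟨Nat.sSup_mem hne (bddAbove_lcdMinWeights F n k),
    fun d hd => le_csSup (bddAbove_lcdMinWeights F n k) hd⟩

open Finset Matrix QuadraticMap

/-!
Over `𝔽₃` the norm `x ⬝ᵥ x` is the weight of `x` modulo `3`. On an LCD code `C` of dimension `4` it
is a nondegenerate quadratic form, hyperbolic or elliptic, and each type takes every value a known
number of times. If all nonzero weights are at least `d`, the weight of `x ≠ 0` is therefore `d`,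
plus the residue of `x ⬝ᵥ x - d`, plus `3` times an excess. Every coordinate that does not vanish on
`C` is nonzero on exactly two thirds of `C`, so adding up the weights determines the number of such
coordinates in terms of `d`, the type and the total excess. As that number is at most `n`, this
bounds `d`.

For `n = 40 * s + 6` and `d = 27 * s + 3` the form would be hyperbolic and the total excess equal to
`4`. But if `z` is isotropic, then on each line `x + 𝔽₃ z` with `z ⬝ᵥ x ≠ 0` the norm takes every
value once; the total weight of the `x` with `z ⬝ᵥ x ≠ 0` is divisible by `18`, hence so is `3`
times their total excess. Choosing `z` with `z ⬝ᵥ x ≠ 0` for some `x` of positive excess forces a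
total excess of at least `6`.

Conversely, placing `s` copies of the simplex code of length `40`, which is self-orthogonal with
constant weight `27`, next to an LCD code of length `r` preserves its Gram matrix and adds `27 * s`
to every nonzero weight. So one code for each residue `r` suffices.
-/

section Counting

theorem card_ker_dvd_card_filter {A B : Type*} [AddGroup A] [Fintype A] [AddGroup B]
    (f : A →+ B) (p : B → Prop) [DecidablePred p] :
    Nat.card f.ker ∣ #{x | p (f x)} := by
  classical
  rw [card_eq_sum_card_image f]
  refine dvd_sum fun b hb => ?_
  obtain ⟨a, ha, rfl⟩ := mem_image.1 hb
  have hfiber : ({x ∈ {x | p (f x)} | f x = f a} : Finset A) = ({x | f x = f a} : Finset A) := by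
    rw [filter_filter]
    refine filter_congr fun x _ => and_iff_right_of_imp fun hx => ?_
    rw [hx]
    exact (mem_filter.1 ha).2
  have hker : #{x | f x = 0} = Nat.card f.ker := by
    rw [← Fintype.card_subtype, ← Nat.card_eq_fintype_card]
    rfl
  rw [hfiber, AddMonoidHom.card_fiber_eq_of_mem_range f ⟨a, rfl⟩ ⟨0, map_zero f⟩, hker]

variable {F V : Type*} [Field F] [Fintype F] [DecidableEq F] [AddCommGroup V] [Module F V]
  [Fintype V]

theorem card_mul_card_filter_eq {φ : V →ₗ[F] F} (hφ : φ ≠ 0) (a : F) :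
    Fintype.card F * #{x | φ x = a} = Fintype.card V := by
  have hrange (b : F) : b ∈ Set.range φ.toAddMonoidHom := LinearMap.surjective hφ b
  have hfiber (b : F) : #{x | φ x = b} = #{x | φ x = a} :=
    AddMonoidHom.card_fiber_eq_of_mem_range φ.toAddMonoidHom (hrange b) (hrange a)
  calc Fintype.card F * #{x | φ x = a}
      = ∑ b, #{x | φ x = b} := by simp only [hfiber, sum_const, card_univ, smul_eq_mul]
    _ = Fintype.card V := (card_eq_sum_card_fiberwise fun _ _ => mem_coe.2 (mem_univ _)).symm

theorem card_mul_card_filter_ne_zero {φ : V →ₗ[F] F} (hφ : φ ≠ 0) :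
    Fintype.card F * #{x | φ x ≠ 0} = (Fintype.card F - 1) * Fintype.card V := by
  have hker := card_mul_card_filter_eq hφ 0
  have hsplit := card_filter_add_card_filter_not (s := univ) (fun x => φ x = 0)
  rw [card_univ] at hsplit
  rw [Nat.sub_mul, one_mul, ← hsplit, Nat.mul_add, hsplit, hker, Nat.add_sub_cancel_left]

theorem card_filter_ne_zero_and_ne_zero (φ ψ : V →ₗ[F] F) :
    #{x | φ x ≠ 0 ∧ ψ x ≠ 0} = (Fintype.card F - 1) * #{x | φ x = 1 ∧ ψ x ≠ 0} := by
  have hfiber : ∀ a ∈ ({a | a ≠ 0} : Finset F),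
      #{x ∈ ({x | φ x ≠ 0 ∧ ψ x ≠ 0} : Finset V) | φ x = a} = #{x | φ x = 1 ∧ ψ x ≠ 0} := by
    intro a ha
    have ha0 : a ≠ 0 := (mem_filter.1 ha).2
    refine card_bij' (fun x _ => a⁻¹ • x) (fun x _ => a • x) ?_ ?_ ?_ ?_
    all_goals simp +contextual [ha0]
  have hmaps : Set.MapsTo φ ({x | φ x ≠ 0 ∧ ψ x ≠ 0} : Finset V) ({a | a ≠ 0} : Finset F) := by
    simp +contextual [Set.MapsTo]
  rw [card_eq_sum_card_fiberwise hmaps, sum_congr rfl hfiber, sum_const, smul_eq_mul,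
    filter_ne', card_erase_of_mem (mem_univ 0), card_univ]

theorem dvd_card_filter_ne_zero_and_ne_zero (φ ψ : V →ₗ[F] F) :
    (Fintype.card F - 1) * Fintype.card F ^ (Module.finrank F V - 2) ∣
      #{x | φ x ≠ 0 ∧ ψ x ≠ 0} := by
  have hfinrank : Module.finrank F V - 2 ≤ Module.finrank F (LinearMap.ker (φ.prod ψ)) := by
    have hrange := (LinearMap.range (φ.prod ψ)).finrank_le
    have hadd := (φ.prod ψ).finrank_range_add_finrank_ker
    rw [Module.finrank_prod, Module.finrank_self] at hrange
    omega
  rw [card_filter_ne_zero_and_ne_zero]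
  refine mul_dvd_mul_left _ ((pow_dvd_pow _ hfinrank).trans ?_)
  rw [← Nat.card_eq_fintype_card (α := F), ← Module.natCard_eq_pow_finrank]
  exact card_ker_dvd_card_filter (φ.prod ψ).toAddMonoidHom fun b => b.1 = 1 ∧ b.2 ≠ 0

end Counting

namespace LinearCode

variable {F : Type*} [Field F] {n : ℕ}

/-- The `k`-th coordinate, as a linear functional on the code. -/
def coordinate (C : LinearCode F n) (k : Fin n) : C →ₗ[F] F := LinearMap.proj k ∘ₗ C.subtype

/-- The effective length of a code: the number of coordinates that do not vanish identically on
it. -/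
noncomputable def effectiveLength (C : LinearCode F n) : ℕ := {k | C.coordinate k ≠ 0}.ncard

theorem effectiveLength_le (C : LinearCode F n) : C.effectiveLength ≤ n := by
  simpa [effectiveLength] using Set.ncard_le_card {k | C.coordinate k ≠ 0}

variable [DecidableEq F] (C : LinearCode F n)

theorem minWeight_le_hammingNorm {C : LinearCode F n} {x : Fin n → F} (hx : x ∈ C) (h0 : x ≠ 0) :
    C.minWeight ≤ hammingNorm x :=
  Nat.sInf_le ⟨x, hx, h0, rfl⟩

theorem sum_hammingNorm_filter [Fintype C] (p : C → Prop) [DecidablePred p] :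
    ∑ x with p x, hammingNorm x.1 = ∑ k, #{x | p x ∧ C.coordinate k x ≠ 0} := by
  simp only [hammingNorm, card_filter]
  rw [sum_comm]
  simp only [← card_filter, filter_filter]
  rfl

variable [Fintype F] [Fintype C]

theorem card_mul_sum_hammingNorm :
    Fintype.card F * ∑ x : C, hammingNorm x.1 =
      (Fintype.card F - 1) * Fintype.card C * C.effectiveLength := by
  classical
  have hsum : ∑ x : C, hammingNorm x.1 = ∑ k, #{x | C.coordinate k x ≠ 0} := by
    simpa using C.sum_hammingNorm_filter fun _ => True
  have hcoord (k : Fin n) : Fintype.card F * #{x | C.coordinate k x ≠ 0} =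
      if C.coordinate k ≠ 0 then (Fintype.card F - 1) * Fintype.card C else 0 := by
    split_ifs with hk
    · exact card_mul_card_filter_ne_zero hk
    · simp [not_not.1 hk]
  rw [hsum, mul_sum, sum_congr rfl fun k _ => hcoord k, ← sum_filter, sum_const, smul_eq_mul,
    mul_comm, effectiveLength, Set.ncard_eq_toFinset_card', Set.toFinset_ofPred]

theorem dvd_sum_hammingNorm_filter_ne_zero (φ : C →ₗ[F] F) :
    (Fintype.card F - 1) * Fintype.card F ^ (Module.finrank F C - 2) ∣
      ∑ x with φ x ≠ 0, hammingNorm x.1 := by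
  rw [sum_hammingNorm_filter]
  exact dvd_sum fun k _ => dvd_card_filter_ne_zero_and_ne_zero φ (C.coordinate k)

end LinearCode

section QuadraticForms

theorem card_smul_sum_comp_polar_ne_zero {F V M : Type*} [Field F] [Fintype F] [DecidableEq F]
    [AddCommGroup V] [Module F V] [Fintype V] [AddCommMonoid M] (Q : QuadraticForm F V) {z : V}
    (hz : Q z = 0) (f : F → M) :
    Fintype.card F • ∑ x with polar Q z x ≠ 0, f (Q x) =
      #{x | polar Q z x ≠ 0} • ∑ a, f a := by
  have hpolar (x : V) (t : F) : polar Q z (x + t • z) = polar Q z x := by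
    rw [polar_add_right, polar_smul_right, polar_self, hz, smul_zero, smul_zero, add_zero]
  have hvalue (x : V) (t : F) : Q (x + t • z) = Q x + polar Q z x * t := by
    rw [QuadraticMap.map_add Q, QuadraticMap.map_smul, hz, polar_smul_right, smul_zero, add_zero,
      smul_eq_mul, mul_comm, polar_comm]
  have htranslate (t : F) : ∑ x with polar Q z x ≠ 0, f (Q x) =
      ∑ x with polar Q z x ≠ 0, f (Q (x + t • z)) :=
    (sum_equiv (Equiv.addRight (t • z)) (by simp [hpolar]) (by simp)).symm
  have hline : ∀ x ∈ ({x | polar Q z x ≠ 0} : Finset V),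
      ∑ t : F, f (Q (x + t • z)) = ∑ a, f a := by
    intro x hx
    simp only [hvalue]
    exact ((Equiv.mulLeft₀ _ (mem_filter.1 hx).2).trans (Equiv.addLeft (Q x))).sum_comp f
  calc Fintype.card F • ∑ x with polar Q z x ≠ 0, f (Q x)
      = ∑ t : F, ∑ x with polar Q z x ≠ 0, f (Q (x + t • z)) := by
        simp only [← htranslate, sum_const, card_univ]
    _ = ∑ x with polar Q z x ≠ 0, ∑ t, f (Q (x + t • z)) := sum_comm
    _ = #{x | polar Q z x ≠ 0} • ∑ a, f a := by
        rw [sum_congr rfl hline, sum_const]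

theorem sum_zmod_three {M : Type*} [AddCommMonoid M] {a : ZMod 3} (ha : a ≠ 0) (f : ZMod 3 → M) :
    ∑ x, f x = f 0 + f a + f (-a) := by
  obtain rfl | rfl : a = 1 ∨ a = -1 := by decide +revert
  · exact Fin.sum_univ_three f
  · exact (Fin.sum_univ_three f).trans (add_right_comm _ _ _)

/-- The function `q`, in practice a nondegenerate ternary quadratic form in `2 * m` variables, has
sign `η`: hyperbolic for `η = 1` and elliptic for `η = -1`. The sign is encoded by the distribution
of the values of `q`, which is all that is used. -/
def HasSign {X : Type*} [Fintype X] (q : X → ZMod 3) (m : ℕ) (η : ℤˣ) : Prop :=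
  ∀ f : ZMod 3 → ℤ,
    3 * ∑ x, f (q x) = (9 ^ m - η * 3 ^ m) * ∑ a, f a + 3 * (η * 3 ^ m) * f 0

namespace HasSign

variable {X Y : Type*} [Fintype X] [Fintype Y] {q : X → ZMod 3} {m : ℕ} {η : ℤˣ}

theorem card_eq (h : HasSign q m η) : Fintype.card X = 9 ^ m := by
  have hone := h fun _ => 1
  simp only [sum_const, card_univ, nsmul_eq_mul, ZMod.card] at hone
  zify
  push_cast at hone
  linarith

theorem of_equiv {q' : Y → ZMod 3} (h : HasSign q m η) (e : Y ≃ X) (he : ∀ y, q' y = q (e y)) :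
    HasSign q' m η := fun f => by
  rw [← h f, ← e.sum_comp fun x => f (q x)]
  simp only [he]

theorem add {q' : Y → ZMod 3} {m' : ℕ} {η' : ℤˣ} (h : HasSign q m η) (h' : HasSign q' m' η') :
    HasSign (fun p : X × Y => q p.1 + q' p.2) (m + m') (η * η') := by
  intro f
  have hinner (x : X) : 3 * ∑ y, f (q x + q' y) =
      (9 ^ m' - η' * 3 ^ m') * ∑ a, f a + 3 * (η' * 3 ^ m') * f (q x) := by
    have hshift : ∑ a, f (q x + a) = ∑ a, f a :=
      Fintype.sum_equiv (Equiv.addLeft (q x)) _ f fun _ => rfl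
    rw [h' fun a => f (q x + a), add_zero, hshift]
  rw [Fintype.sum_prod_type, mul_sum, sum_congr rfl fun x _ => hinner x, sum_add_distrib,
    ← mul_sum univ (fun x => f (q x)), sum_const, card_univ, h.card_eq, nsmul_eq_mul]
  push_cast
  linear_combination η' * 3 ^ m' * h f

theorem exists_eq_zero_and_ne_zero {V : Type*} [AddCommGroup V] [Module (ZMod 3) V] [Fintype V]
    {q : V → ZMod 3} (h : HasSign q m 1) {φ : V →ₗ[ZMod 3] ZMod 3} (hφ : φ ≠ 0) :
    ∃ z, q z = 0 ∧ φ z ≠ 0 := by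
  by_contra! hzero
  have hle : #{x | q x = 0} ≤ #{x | φ x = 0} :=
    card_le_card fun x hx => by simpa using hzero x (by simpa using hx)
  have hcount := h fun a => if a = 0 then 1 else 0
  have hplane := card_mul_card_filter_eq hφ 0
  simp only [sum_boole, filter_eq', mem_univ, if_true, card_singleton, Nat.cast_one,
    Units.val_one] at hcount
  rw [ZMod.card, h.card_eq] at hplane
  zify at hle hplane
  have hpow : (0 : ℤ) < 3 ^ m := by positivity
  linarith

end HasSign

theorem exists_hasSign_binary {a b : ZMod 3} (ha : a ≠ 0) (hb : b ≠ 0) :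
    ∃ η, HasSign (fun p : ZMod 3 × ZMod 3 => a * (p.1 * p.1) + b * (p.2 * p.2)) 1 η := by
  have hb' : b = a ∨ b = -a := by decide +revert
  have hneg : a + a = -a := by decide +revert
  have hexpand (f : ZMod 3 → ℤ) : ∑ x : ZMod 3 × ZMod 3, f (a * (x.1 * x.1) + b * (x.2 * x.2)) =
      f 0 + 2 * f a + 2 * f b + 4 * f (a + b) := by
    simp only [Fintype.sum_prod_type, sum_zmod_three one_ne_zero, mul_zero, mul_one, neg_mul_neg,
      zero_add, add_zero]
    ring
  rcases hb' with rfl | rfl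
  · refine ⟨-1, fun f => ?_⟩
    rw [hexpand, sum_zmod_three hb, hneg]
    push_cast
    ring
  · refine ⟨1, fun f => ?_⟩
    rw [hexpand, sum_zmod_three ha, add_neg_cancel]
    push_cast
    ring

theorem exists_hasSign_sum_mul_self : ∀ (m : ℕ) (w : Fin (2 * m) → ZMod 3) (_ : ∀ i, w i ≠ 0),
    ∃ η, HasSign (fun x : Fin (2 * m) → ZMod 3 => ∑ i, w i * (x i * x i)) m η
  | 0, w, _ => ⟨1, fun f => by simp⟩
  | m + 1, w, hw => by
    obtain ⟨η, h⟩ := exists_hasSign_sum_mul_self m (fun i => w (i.castAdd 2)) fun i => hw _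
    obtain ⟨η', h'⟩ := exists_hasSign_binary (hw (.natAdd (2 * m) 0)) (hw (.natAdd (2 * m) 1))
    refine ⟨η * η', (h.add h').of_equiv ((Fin.appendEquiv (2 * m) 2).symm.trans
      ((Equiv.refl _).prodCongr (finTwoArrowEquiv _))) fun x => ?_⟩
    exact (Fin.sum_univ_add _).trans (congrArg _ (Fin.sum_univ_two _))

theorem exists_hasSign_of_separatingLeft {V : Type*} [AddCommGroup V] [Module (ZMod 3) V]
    [Fintype V] [Invertible (2 : ZMod 3)] {Q : QuadraticForm (ZMod 3) V}
    (hQ : (associated (R := ZMod 3) Q).SeparatingLeft) {m : ℕ}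
    (hm : Module.finrank (ZMod 3) V = 2 * m) : ∃ η, HasSign Q m η := by
  obtain ⟨w, ⟨e⟩⟩ := Q.equivalent_weightedSumSquares_units_of_nondegenerate' hQ
  obtain ⟨η, h⟩ := exists_hasSign_sum_mul_self m (fun i => (w (i.cast hm.symm) : ZMod 3))
    fun i => (w _).ne_zero
  refine ⟨η, h.of_equiv (e.toEquiv.trans ((finCongr hm).arrowCongr (Equiv.refl _))) fun x => ?_⟩
  rw [← e.map_app x, weightedSumSquares_apply, ← (finCongr hm.symm).sum_comp]
  rfl

end QuadraticForms

namespace LinearCode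

section NormForm

variable {F : Type*} [Field F] {n : ℕ} {C : LinearCode F n}

/-- The quadratic form `x ↦ ∑ i, x i ^ 2` on a code. -/
def normForm (C : LinearCode F n) : QuadraticForm F C :=
  LinearMap.BilinMap.toQuadraticMap ((dotProductBilin F F).compl₁₂ C.subtype C.subtype)

theorem normForm_apply (x : C) : C.normForm x = x.1 ⬝ᵥ x.1 := rfl

theorem associated_normForm [Invertible (2 : F)] (x y : C) :
    associated (R := F) C.normForm x y = x.1 ⬝ᵥ y.1 := by
  rw [normForm, associated_left_inverse _ fun a b : C => dotProduct_comm a.1 b.1]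
  rfl

theorem polar_normForm (x y : C) : polar C.normForm x y = 2 * (x.1 ⬝ᵥ y.1) := by
  rw [normForm, LinearMap.BilinMap.polar_toQuadraticMap, two_mul]
  exact congrArg _ (dotProduct_comm y.1 x.1)

theorem IsLCD.eq_zero_of_dotProduct_eq_zero (hC : C.IsLCD) {x : C}
    (h : ∀ y : C, x.1 ⬝ᵥ y.1 = 0) : x = 0 := by
  have hmem : x.1 ∈ C ⊓ C.dual := ⟨x.2, fun y hy => h ⟨y, hy⟩⟩
  rw [hC, Submodule.mem_bot] at hmem
  exact Subtype.ext hmem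

theorem IsLCD.separatingLeft_associated_normForm [Invertible (2 : F)] (hC : C.IsLCD) :
    (associated (R := F) C.normForm).SeparatingLeft := fun x hx =>
  hC.eq_zero_of_dotProduct_eq_zero fun y => (associated_normForm x y).symm.trans (hx y)

theorem IsLCD.polarBilin_normForm_ne_zero (h2 : (2 : F) ≠ 0) (hC : C.IsLCD) {x : C} (hx : x ≠ 0) :
    C.normForm.polarBilin x ≠ 0 := fun h => hx <| hC.eq_zero_of_dotProduct_eq_zero fun y =>
  (mul_eq_zero.1 ((polar_normForm x y).symm.trans (LinearMap.congr_fun h y))).resolve_left h2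

end NormForm

section Ternary

variable {n : ℕ}

theorem natCast_hammingNorm (x : Fin n → ZMod 3) : (hammingNorm x : ZMod 3) = x ⬝ᵥ x := by
  have hsq (a : ZMod 3) : (if a ≠ 0 then 1 else 0) = a * a := by decide +revert
  simp only [hammingNorm, natCast_card_filter, hsq, dotProduct]

/-- The part of the weight of `x` exceeding `d`, in units of `3`, that the norm `x ⬝ᵥ x` does not
determine. The truncated subtraction makes it vanish on words of weight less than `d`, in
particular on the zero word. -/
def excess (d : ℕ) (x : Fin n → ZMod 3) : ℕ := (hammingNorm x - d) / 3

theorem hammingNorm_eq_add_excess {d : ℕ} {x : Fin n → ZMod 3} (hd : d ≤ hammingNorm x) :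
    hammingNorm x = d + (x ⬝ᵥ x - d).val + 3 * excess d x := by
  obtain ⟨t, ht⟩ := Nat.exists_eq_add_of_le hd
  rw [← natCast_hammingNorm, excess, ht, Nat.cast_add, add_sub_cancel_left, ZMod.val_natCast]
  omega

theorem sum_val_sub (d : ZMod 3) : ∑ a, (a - d).val = 3 := by
  decide +revert

variable {C : LinearCode (ZMod 3) n} {d : ℕ}

theorem hammingNorm_add_ite (hd : d ≤ C.minWeight) (x : C) :
    hammingNorm x.1 + (if x = 0 then d + (-d : ZMod 3).val else 0) =
      d + (C.normForm x - d).val + 3 * excess d x.1 := by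
  split_ifs with hx
  · simp [hx, excess]
  · rw [add_zero, normForm_apply]
    exact hammingNorm_eq_add_excess
      (hd.trans (minWeight_le_hammingNorm x.2 (Subtype.coe_ne_coe.2 hx)))

theorem effectiveLength_eq [Fintype C] {m : ℕ} {η : ℤˣ} (h : HasSign C.normForm m η)
    (hd : d ≤ C.minWeight) :
    (2 * 9 ^ m * C.effectiveLength + 3 * (d + (-d : ZMod 3).val) : ℤ) =
      3 * 9 ^ m * d + 3 * (9 ^ m - η * 3 ^ m) + 3 * (η * 3 ^ m) * (-d : ZMod 3).val +
        9 * ∑ x : C, excess d x.1 := by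
  have hweight := C.card_mul_sum_hammingNorm
  have hval := h fun a => (a - d).val
  have hsum := sum_congr rfl fun x (_ : x ∈ univ) => hammingNorm_add_ite hd x
  simp only [sum_add_distrib, sum_ite_eq', mem_univ, if_true, sum_const, card_univ, h.card_eq,
    smul_eq_mul, ← mul_sum] at hsum
  rw [ZMod.card, h.card_eq] at hweight
  rw [zero_sub] at hval
  have hthree : (∑ a : ZMod 3, ((a - d).val : ℤ)) = 3 := mod_cast sum_val_sub d
  rw [hthree] at hval
  zify at hsum hweight ⊢
  linarith

theorem dvd_sum_excess [Fintype C] (hd : d ≤ C.minWeight) {z : C} (hz : C.normForm z = 0) :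
    2 * 3 ^ (Module.finrank (ZMod 3) C - 2) ∣
      3 * ∑ x with polar C.normForm z x ≠ 0, excess d x.1 := by
  have hweight : 2 * 3 ^ (Module.finrank (ZMod 3) C - 2) ∣
      ∑ x with polar C.normForm z x ≠ 0, hammingNorm x.1 :=
    C.dvd_sum_hammingNorm_filter_ne_zero (C.normForm.polarBilin z)
  have hcard : 2 * 3 ^ (Module.finrank (ZMod 3) C - 2) ∣ #{x | polar C.normForm z x ≠ 0} := by
    simpa using dvd_card_filter_ne_zero_and_ne_zero (C.normForm.polarBilin z)
      (C.normForm.polarBilin z)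
  have hval : ∑ x with polar C.normForm z x ≠ 0, (C.normForm x - d).val =
      #{x | polar C.normForm z x ≠ 0} := by
    have h := card_smul_sum_comp_polar_ne_zero C.normForm hz fun a => (a - d).val
    rw [sum_val_sub, ZMod.card, smul_eq_mul, smul_eq_mul, mul_comm] at h
    exact Nat.eq_of_mul_eq_mul_right three_pos h
  have hsplit : ∑ x with polar C.normForm z x ≠ 0, hammingNorm x.1 =
      #{x | polar C.normForm z x ≠ 0} * (d + 1) +
        3 * ∑ x with polar C.normForm z x ≠ 0, excess d x.1 := by
    have hterm : ∀ x ∈ ({x | polar C.normForm z x ≠ 0} : Finset C),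
        hammingNorm x.1 = d + (C.normForm x - d).val + 3 * excess d x.1 := by
      intro x hx
      have hx0 : x ≠ 0 := by
        rintro rfl
        simp at hx
      rw [← hammingNorm_add_ite hd, if_neg hx0, add_zero]
    rw [sum_congr rfl hterm, sum_add_distrib, sum_add_distrib, hval, sum_const, mul_sum,
      smul_eq_mul, Nat.mul_succ]
  rw [hsplit] at hweight
  exact (Nat.dvd_add_right (hcard.mul_right _)).1 hweight

theorem IsLCD.le_sum_excess [Fintype C] {m : ℕ} (hC : C.IsLCD) (hsign : HasSign C.normForm m 1)
    (hd : d ≤ C.minWeight) (hexcess : ∑ x : C, excess d x.1 ≠ 0) :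
    2 * 3 ^ (Module.finrank (ZMod 3) C - 2) ≤ 3 * ∑ x : C, excess d x.1 := by
  obtain ⟨x, -, hx⟩ := exists_ne_zero_of_sum_ne_zero hexcess
  have hx0 : x ≠ 0 := by
    rintro rfl
    simp [excess] at hx
  obtain ⟨z, hz, hxz⟩ := hsign.exists_eq_zero_and_ne_zero
    (hC.polarBilin_normForm_ne_zero (by decide) hx0)
  rw [polarBilin_apply_apply, polar_comm] at hxz
  have hpos : 0 < ∑ x with polar C.normForm z x ≠ 0, excess d x.1 :=
    sum_pos' (fun _ _ => Nat.zero_le _) ⟨x, mem_filter.2 ⟨mem_univ x, hxz⟩, Nat.pos_of_ne_zero hx⟩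
  calc 2 * 3 ^ (Module.finrank (ZMod 3) C - 2)
      ≤ 3 * ∑ x with polar C.normForm z x ≠ 0, excess d x.1 :=
        Nat.le_of_dvd (Nat.mul_pos three_pos hpos) (dvd_sum_excess hd hz)
    _ ≤ 3 * ∑ x : C, excess d x.1 :=
        Nat.mul_le_mul_left 3 (sum_le_sum_of_subset (filter_subset _ _))

theorem IsLCD.exists_hasSign [Fintype C] (hC : C.IsLCD) {m : ℕ}
    (hm : Module.finrank (ZMod 3) C = 2 * m) : ∃ η, HasSign C.normForm m η := by
  have : Invertible (2 : ZMod 3) := ⟨2, rfl, rfl⟩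
  exact exists_hasSign_of_separatingLeft hC.separatingLeft_associated_normForm hm

theorem IsLCD.effectiveLength_eq_or [Fintype C] (hC : C.IsLCD)
    (hdim : Module.finrank (ZMod 3) C = 4) (hd : d ≤ C.minWeight) :
    HasSign C.normForm 2 1 ∧ 54 * C.effectiveLength =
        80 * d + 72 + 8 * (-d : ZMod 3).val + 3 * ∑ x : C, excess d x.1 ∨
      HasSign C.normForm 2 (-1) ∧ 54 * C.effectiveLength + 10 * (-d : ZMod 3).val =
        80 * d + 90 + 3 * ∑ x : C, excess d x.1 := by
  obtain ⟨η, h⟩ := hC.exists_hasSign (m := 2) hdim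
  have hlength := effectiveLength_eq h hd
  obtain rfl | rfl := Int.units_eq_one_or η
  · refine .inl ⟨h, ?_⟩
    push_cast at hlength
    zify
    linarith
  · refine .inr ⟨h, ?_⟩
    push_cast at hlength
    zify
    linarith

theorem IsLCD.weight_bound (hC : C.IsLCD) (hdim : Module.finrank (ZMod 3) C = 4) :
    40 * C.minWeight + 35 ≤ 27 * n := by
  have := Fintype.ofFinite C
  have hle := C.effectiveLength_le
  have hval := ZMod.val_lt (-C.minWeight : ZMod 3)
  obtain ⟨-, hlength⟩ | ⟨-, hlength⟩ := hC.effectiveLength_eq_or hdim le_rfl <;> omega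

theorem IsLCD.minWeight_lt_of_eq_forty_mul_add_six (hC : C.IsLCD)
    (hdim : Module.finrank (ZMod 3) C = 4) {s : ℕ} (hn : n = 40 * s + 6) :
    C.minWeight < 27 * s + 3 := by
  have := Fintype.ofFinite C
  by_contra! hd
  have hval : (-((27 * s + 3 : ℕ) : ZMod 3)).val = 0 := by
    rw [ZMod.val_eq_zero, neg_eq_zero, ZMod.natCast_eq_zero_iff]
    omega
  have hle := C.effectiveLength_le
  obtain ⟨hsign, hlength⟩ | ⟨-, hlength⟩ := hC.effectiveLength_eq_or hdim hd
  on_goal 2 => omega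
  have hexcess : ∑ x : C, excess (27 * s + 3) x.1 = 4 := by omega
  have hlarge := hC.le_sum_excess hsign hd (hexcess.trans_ne four_ne_zero)
  rw [hdim, hexcess] at hlarge
  omega

end Ternary

end LinearCode

theorem largestLCDMinWeight_lt {F : Type*} [Field F] [DecidableEq F] {n k m : ℕ} (hm : 0 < m)
    (h : ∀ C : LinearCode F n, Module.finrank F C = k → C.IsLCD → C.minWeight < m) :
    largestLCDMinWeight F n k < m := by
  by_contra! hle
  obtain ⟨⟨C, hk, hC, hw⟩, -⟩ := isGreatest_largestLCDMinWeight F n k (by omega)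
  have hlt := h C hk hC
  omega

section HammingNorm

variable {R ι κ : Type*} [Zero R] [DecidableEq R] [Fintype ι] [Fintype κ]

theorem hammingNorm_eq_sum (x : ι → R) : hammingNorm x = ∑ i, if x i ≠ 0 then 1 else 0 :=
  card_filter _ _

theorem hammingNorm_comp_equiv (x : ι → R) (e : κ ≃ ι) : hammingNorm (x ∘ e) = hammingNorm x := by
  rw [hammingNorm_eq_sum, hammingNorm_eq_sum]
  exact e.sum_comp fun i => if x i ≠ 0 then 1 else 0

theorem hammingNorm_sumElim (x : ι → R) (y : κ → R) :
    hammingNorm (Sum.elim x y) = hammingNorm x + hammingNorm y := by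
  rw [hammingNorm_eq_sum, Fintype.sum_sum_type, hammingNorm_eq_sum x, hammingNorm_eq_sum y]
  rfl

theorem hammingNorm_comp_snd (x : κ → R) :
    hammingNorm (fun p : ι × κ => x p.2) = Fintype.card ι * hammingNorm x := by
  have hcopy : hammingNorm (fun p : ι × κ => x p.2) = ∑ _i : ι, hammingNorm x := by
    rw [hammingNorm_eq_sum, Fintype.sum_prod_type, hammingNorm_eq_sum x]
  rw [hcopy, sum_const, card_univ, smul_eq_mul]

end HammingNorm

section Construction

variable {F ι κ : Type*} [Field F] [Fintype ι] [Fintype κ] {k n : ℕ}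

theorem vecMul_injective_of_isUnit_mul_transpose {G : Matrix (Fin k) ι F}
    (hG : IsUnit (G * Gᵀ)) : Function.Injective G.vecMul := fun x y hxy =>
  vecMul_injective_of_isUnit hG <| by
    simp only [← vecMul_vecMul]
    exact congrArg (· ᵥ* Gᵀ) hxy

theorem isLCD_range_vecMulLinear {G : Matrix (Fin k) (Fin n) F} (hG : IsUnit (G * Gᵀ)) :
    LinearCode.IsLCD (LinearMap.range G.vecMulLinear) := by
  rw [LinearCode.IsLCD, Submodule.eq_bot_iff]
  rintro _ ⟨⟨x, rfl⟩, hdual⟩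
  have hGram : x ᵥ* (G * Gᵀ) = 0 ᵥ* (G * Gᵀ) := by
    rw [← vecMul_vecMul, vecMul_transpose, zero_vecMul]
    funext i
    have hrow : Pi.single i 1 ᵥ* G = G i := single_one_vecMul i G
    rw [mulVec, dotProduct_comm, ← hrow]
    exact hdual _ ⟨Pi.single i 1, rfl⟩
  rw [vecMul_injective_of_isUnit hG hGram, map_zero]

variable [DecidableEq F] {m : ℕ}

theorem le_minWeight_range_vecMulLinear [NeZero k] {G : Matrix (Fin k) (Fin n) F}
    (hG : Function.Injective G.vecMul) (hm : ∀ x ≠ 0, m ≤ hammingNorm (x ᵥ* G)) :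
    m ≤ LinearCode.minWeight (LinearMap.range G.vecMulLinear) := by
  have hne : Pi.single 0 1 ᵥ* G ≠ 0 := fun h =>
    Pi.single_ne_zero_iff.2 one_ne_zero (hG (h.trans (zero_vecMul G).symm))
  refine le_csInf ⟨_, _, ⟨_, rfl⟩, hne, rfl⟩ ?_
  rintro _ ⟨_, ⟨x, rfl⟩, hx, rfl⟩
  refine hm x fun h => hx ?_
  rw [h, map_zero]

theorem le_largestLCDMinWeight_of_fin [NeZero k] {G : Matrix (Fin k) (Fin n) F}
    (hG : IsUnit (G * Gᵀ)) (hm : ∀ x ≠ 0, m ≤ hammingNorm (x ᵥ* G)) :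
    m ≤ largestLCDMinWeight F n k := by
  have hinj := vecMul_injective_of_isUnit_mul_transpose hG
  have hdim : Module.finrank F (LinearMap.range G.vecMulLinear) = k := by
    rw [LinearMap.finrank_range_of_inj hinj, Module.finrank_fin_fun]
  exact (le_minWeight_range_vecMulLinear hinj hm).trans
    (le_csSup (bddAbove_lcdMinWeights F n k) ⟨_, hdim, isLCD_range_vecMulLinear hG, rfl⟩)

theorem le_largestLCDMinWeight [NeZero k] {G : Matrix (Fin k) ι F} (hG : IsUnit (G * Gᵀ))
    (hm : ∀ x ≠ 0, m ≤ hammingNorm (x ᵥ* G)) :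
    m ≤ largestLCDMinWeight F (Fintype.card ι) k := by
  set e := (Fintype.equivFin ι).symm
  refine le_largestLCDMinWeight_of_fin (G := G.submatrix id e) ?_ fun x hx => ?_
  · rwa [transpose_submatrix, submatrix_mul_equiv, submatrix_id_id]
  · exact (hm x hx).trans_eq (hammingNorm_comp_equiv (x ᵥ* G) e).symm

theorem mul_add_le_largestLCDMinWeight [NeZero k] {A : Matrix (Fin k) κ F}
    {G : Matrix (Fin k) ι F} {a : ℕ} (hA : A * Aᵀ = 0) (ha : ∀ x ≠ 0, a ≤ hammingNorm (x ᵥ* A))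
    (hG : IsUnit (G * Gᵀ)) (hm : ∀ x ≠ 0, m ≤ hammingNorm (x ᵥ* G)) (s : ℕ) :
    s * a + m ≤ largestLCDMinWeight F (s * Fintype.card κ + Fintype.card ι) k := by
  let B : Matrix (Fin k) (Fin s × κ) F := A.submatrix id Prod.snd
  have hB : B * Bᵀ = 0 := by
    ext i j
    have hij : ∑ c, A i c * A j c = 0 := congrFun₂ hA i j
    simp only [B, mul_apply, transpose_apply, submatrix_apply, id_eq, Fintype.sum_prod_type, hij,
      sum_const_zero, Matrix.zero_apply]
  have hGram : IsUnit (fromCols B G * (fromCols B G)ᵀ) := by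
    rwa [transpose_fromCols, fromCols_mul_fromRows, hB, zero_add]
  have hweight (x : Fin k → F) (hx : x ≠ 0) :
      s * a + m ≤ hammingNorm (x ᵥ* fromCols B G) := by
    have hcopies : hammingNorm (x ᵥ* B) = s * hammingNorm (x ᵥ* A) :=
      (hammingNorm_comp_snd (x ᵥ* A)).trans (by rw [Fintype.card_fin])
    rw [vecMul_fromCols, hammingNorm_sumElim, hcopies]
    exact add_le_add (Nat.mul_le_mul_left s (ha x hx)) (hm x hx)
  simpa using le_largestLCDMinWeight hGram hweight

end Construction

section Tables

/-- The matrix whose columns are the four lowest base-`3` digits, least significant first, of the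
entries of `L`. -/
def digitMatrix (L : List ℕ) : Matrix (Fin 4) (Fin L.length) (ZMod 3) :=
  of fun i j => ((L.get j / 3 ^ (i : ℕ) : ℕ) : ZMod 3)

-- Weights expressed in `ℕ` rather than `ZMod 3` are cheap to evaluate in the kernel.
theorem hammingNorm_vecMul_digitMatrix (L : List ℕ) (x : Fin 4 → ZMod 3) :
    hammingNorm (x ᵥ* digitMatrix L) =
      (L.map fun t => if ((x 0).val * t + (x 1).val * (t / 3) + (x 2).val * (t / 9) +
        (x 3).val * (t / 27)) % 3 ≠ 0 then 1 else 0).sum := by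
  have hentry (t : ℕ) : ∑ i : Fin 4, x i * ((t / 3 ^ (i : ℕ) : ℕ) : ZMod 3) =
      (((x 0).val * t + (x 1).val * (t / 3) + (x 2).val * (t / 9) + (x 3).val * (t / 27) : ℕ) :
        ZMod 3) := by
    simp [Fin.sum_univ_four]
  have hcolumn (j) : (x ᵥ* digitMatrix L) j =
      ∑ i : Fin 4, x i * ((L[j] / 3 ^ (i : ℕ) : ℕ) : ZMod 3) := rfl
  simp only [hammingNorm_eq_sum, hcolumn, hentry, Ne, ZMod.natCast_eq_zero_iff,
    Nat.dvd_iff_mod_eq_zero]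
  exact Fin.sum_univ_fun_getElem L fun t => if ¬((x 0).val * t + (x 1).val * (t / 3) +
    (x 2).val * (t / 9) + (x 3).val * (t / 27)) % 3 = 0 then 1 else 0

/-- One representative, with leading digit `1`, of each of the `40` points of `PG(3, 3)`. They are
the columns of the simplex code, which is self-orthogonal and has constant weight `27`. -/
def simplexColumns : List ℕ :=
  (List.range 4).flatMap fun i => List.range' (3 ^ i) (3 ^ i)

/-- The residues `r` modulo `40` for which the largest minimum weight at length `40 * s + r` is
`27 * n / 40 - 1`. -/
def regularResidues : Finset ℕ :=
  {4, 5, 7, 8, 10, 11, 14, 16, 17, 19, 20, 24, 26, 29, 30, 33, 35, 36, 38, 39}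

/-- Generator columns, encoded as in `digitMatrix`, of codes of length `r` that are optimal among
LCD codes; found by computer search. -/
def optimalColumns : ℕ → List ℕ
  | 4 => [31, 38, 47, 59]
  | 5 => [18, 40, 52, 70, 76]
  | 6 => [4, 34, 39, 52, 63, 80]
  | 7 => [11, 18, 57, 61, 73, 76, 78]
  | 8 => [9, 23, 26, 29, 48, 66, 72, 74]
  | 10 => [2, 26, 27, 30, 34, 35, 63, 70, 76, 79]
  | 11 => [13, 17, 21, 25, 32, 35, 37, 39, 42, 59, 60]
  | 14 => [2, 3, 13, 17, 19, 24, 34, 36, 46, 51, 61, 63, 73, 78]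
  | 16 => [8, 9, 17, 19, 25, 30, 31, 35, 37, 43, 46, 50, 61, 64, 67, 68]
  | 17 => [6, 14, 26, 30, 35, 38, 45, 55, 56, 57, 59, 64, 65, 66, 74, 75, 78]
  | 19 => [1, 3, 8, 12, 20, 22, 27, 31, 33, 34, 36, 39, 43, 44, 51, 56, 63, 68, 70]
  | 20 => [2, 4, 5, 9, 21, 25, 26, 30, 36, 37, 42, 43, 49, 52, 53, 55, 56, 63, 70, 80]
  | 24 =>
    [4, 7, 13, 17, 21, 23, 24, 25, 29, 36, 37, 40, 41, 44, 46, 47, 50, 56, 63, 67, 68, 71, 73, 77]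
  | 26 =>
    [2, 7, 10, 12, 17, 18, 19, 21, 23, 26, 27, 30, 32, 34, 35, 38, 42, 46, 57, 62, 63, 71, 72, 74,
     77, 78]
  | 29 =>
    [2, 3, 4, 12, 15, 16, 19, 20, 25, 34, 37, 38, 43, 47, 48, 49, 50, 55, 56, 61, 65, 66, 67, 68,
     75, 76, 78, 79, 80]
  | 30 =>
    [2, 6, 8, 9, 11, 13, 14, 15, 16, 17, 28, 29, 30, 31, 36, 37, 38, 39, 42, 44, 57, 58, 59, 61,
     63, 64, 65, 66, 69, 71]
  | 33 =>
    [2, 4, 5, 9, 10, 11, 17, 21, 24, 25, 27, 28, 34, 40, 41, 43, 44, 46, 48, 49, 50, 57, 58, 60,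
     61, 62, 63, 64, 66, 67, 68, 72, 73]
  | 35 =>
    [1, 3, 4, 7, 7, 11, 14, 16, 16, 17, 21, 24, 26, 27, 30, 32, 33, 37, 40, 47, 49, 50, 52, 53,
     58, 58, 59, 62, 66, 69, 73, 75, 76, 78, 79]
  | 36 =>
    [2, 3, 5, 8, 9, 11, 14, 15, 17, 20, 23, 24, 26, 27, 30, 33, 36, 37, 39, 43, 45, 48, 49, 52,
     55, 56, 58, 59, 64, 65, 67, 70, 73, 76, 79, 80]
  | 38 =>
    [2, 3, 5, 5, 8, 9, 10, 12, 13, 15, 16, 19, 22, 28, 29, 30, 31, 32, 33, 34, 36, 37, 38, 39, 40,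
     41, 42, 43, 43, 45, 45, 46, 47, 49, 50, 51, 52, 53]
  | 39 =>
    [2, 3, 7, 8, 9, 10, 11, 12, 13, 14, 16, 16, 17, 17, 29, 30, 31, 36, 37, 38, 39, 41, 42, 43,
     44, 54, 56, 57, 57, 58, 61, 63, 63, 64, 67, 68, 69, 70, 71]
  | _ => []

theorem length_simplexColumns : simplexColumns.length = 40 := by decide

theorem simplex_gram : digitMatrix simplexColumns * (digitMatrix simplexColumns)ᵀ = 0 := by
  decide +kernel

theorem simplex_weight : ∀ x : Fin 4 → ZMod 3, x ≠ 0 →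
    27 ≤ hammingNorm (x ᵥ* digitMatrix simplexColumns) := by
  simp only [hammingNorm_vecMul_digitMatrix]
  decide +kernel

theorem length_optimalColumns : ∀ r ∈ insert 6 regularResidues, (optimalColumns r).length = r := by
  decide

theorem optimalColumns_gram : ∀ r ∈ insert 6 regularResidues, ∀ i j,
    (digitMatrix (optimalColumns r) * (digitMatrix (optimalColumns r))ᵀ) i j = 0 ↔ i ≠ j := by
  decide +kernel

theorem isUnit_optimalColumns_gram {r : ℕ} (hr : r ∈ insert 6 regularResidues) :
    IsUnit (digitMatrix (optimalColumns r) * (digitMatrix (optimalColumns r))ᵀ) := by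
  have hgram := optimalColumns_gram r hr
  have hdiag : (digitMatrix (optimalColumns r) * (digitMatrix (optimalColumns r))ᵀ).IsDiag :=
    fun i j hij => (hgram i j).2 hij
  rw [← hdiag.diagonal_diag, isUnit_diagonal, Pi.isUnit_iff]
  exact fun i => isUnit_iff_ne_zero.2 fun h => (hgram i i).1 h rfl

theorem optimalColumns_weight : ∀ r ∈ insert 6 regularResidues, ∀ x : Fin 4 → ZMod 3, x ≠ 0 →
    27 * r / 40 - (if r = 6 then 2 else 1) ≤ hammingNorm (x ᵥ* digitMatrix (optimalColumns r)) := by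
  simp only [hammingNorm_vecMul_digitMatrix]
  decide +kernel

theorem le_largestLCDMinWeight_of_mem {r : ℕ} (hr : r ∈ insert 6 regularResidues) (s : ℕ) :
    s * 27 + (27 * r / 40 - if r = 6 then 2 else 1) ≤
      largestLCDMinWeight (ZMod 3) (s * 40 + r) 4 := by
  have h := mul_add_le_largestLCDMinWeight simplex_gram simplex_weight
    (isUnit_optimalColumns_gram hr) (optimalColumns_weight r hr) s
  rwa [Fintype.card_fin, Fintype.card_fin, length_simplexColumns, length_optimalColumns r hr] at h

end Tables

theorem largestLCDMinWeight_le {n : ℕ} (hr : 27 * n % 40 < 35) :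
    largestLCDMinWeight (ZMod 3) n 4 ≤ 27 * n / 40 - 1 := by
  refine Nat.le_of_lt_succ (largestLCDMinWeight_lt (Nat.succ_pos _) fun C hdim hC => ?_)
  have hbound := hC.weight_bound hdim
  omega

theorem largestLCDMinWeight_mul_forty_add_six_lt (s : ℕ) :
    largestLCDMinWeight (ZMod 3) (s * 40 + 6) 4 < 27 * s + 3 :=
  largestLCDMinWeight_lt (Nat.succ_pos _) fun _ hdim hC =>
    hC.minWeight_lt_of_eq_forty_mul_add_six hdim (by omega)

theorem mul_mod_lt_of_mem_regularResidues : ∀ r ∈ regularResidues, 27 * r % 40 < 35 := by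
  decide

theorem mainTheorem2 (n : ℕ) (hn : 4 ≤ n) :
    (n % 40 ∈ ({4, 5, 7, 8, 10, 11, 14, 16, 17, 19, 20, 24, 26, 29, 30, 33, 35, 36, 38, 39} :
        Finset ℕ) →
      (largestLCDMinWeight (ZMod 3) n 4 : ℤ) = ⌊(27 * (n : ℚ)) / 40⌋ - 1) ∧
    (n % 40 = 6 →
      (largestLCDMinWeight (ZMod 3) n 4 : ℤ) = ⌊(27 * (n : ℚ)) / 40⌋ - 2) := by
  have hfloor : ⌊(27 * (n : ℚ)) / 40⌋ = ((27 * n / 40 : ℕ) : ℤ) := by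
    exact_mod_cast Rat.floor_natCast_div_natCast (27 * n) 40
  have hlower (h : n % 40 ∈ insert 6 regularResidues) := le_largestLCDMinWeight_of_mem h (n / 40)
  rw [Nat.div_add_mod'] at hlower
  rw [hfloor]
  refine ⟨fun hr => ?_, fun hr => ?_⟩
  · have hmod := mul_mod_lt_of_mem_regularResidues _ hr
    have hne : n % 40 ≠ 6 := fun h => absurd (h ▸ hr) (by decide)
    have hbound := hlower (mem_insert_of_mem hr)
    rw [Nat.mul_mod_mod] at hmod
    have hupper := largestLCDMinWeight_le hmod
    rw [if_neg hne] at hbound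
    omega
  · have hbound := hlower (mem_insert.2 (.inl hr))
    have hupper := largestLCDMinWeight_mul_forty_add_six_lt (n / 40)
    rw [← hr, Nat.div_add_mod'] at hupper
    rw [if_pos hr] at hbound
    omega
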